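/- Let $E_9$ be the elliptic curve over $\mathbb{Q}$ with Weierstrass equation $y^2 = x^3 - 2^4\cdot 3^7$, let $P_0 = (36,108)\in E_9(\mathbb{Q})$, let $K=\mathbb{Q}(\sqrt{-3})$, and fix an embedding $\overline{\mathbb{Q}}\hookrightarrow\mathbb{C}$ of an algebraic closure of $\mathbb{Q}$. Let $\zeta_9 = e^{2\pi i/9}$. 1. If $A\in E_9(\overline{\mathbb{Q}})$ satisfies $[3]A = P_0$, then $\mathbb{Q}(\zeta_9)\subset \mathbb{Q}(A, E_9[3])$, where $\mathbb{Q}(A,E_9[3])$ is the field generated over $\mathbb{Q}$ by the coordinates of $A$ and of all the points of $E_9(\overline{\mathbb{Q}})$ killed by $3$. Let moreover $p$ be an odd prime with $p\equiv 2$ or $5 \pmod 9$. Then $p$ is inert in $K$ and $E_9$ has good reduction at $p$; let $K_p$ be the completion of $K$ at the prime above $p$. 2. The point $P_0$ is not divisible by $3$ in $E_9(K_p)$: there is no $Q\in E_9(K_p)$ with $[3]Q = P_0$. 3. The reduction of $P_0$ in $E_9(\mathbb{F}_p)$ has nontrivial $3$-component (that is, in its decomposition as a sum of an element of $3$-power order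 and an element of order prime to $3$, the first summand is nonzero), and the reduction of $\left[\frac{p+1}{3}\right]P_0$ in $E_9(\mathbb{F}_p)$ is nonzero. -/

import Mathlib

open scoped WeierstrassCurve.Affine

noncomputable section

namespace CubeSum

open WeierstrassCurve.Affine

/-- The curve `E₉ : y² = x³ - 2⁴·3⁷`, as a Weierstrass equation over `ℤ`. For a field `F`, the
group `E₉(F)` is `(E9⁄F).Point`. -/
def E9 : WeierstrassCurve.Affine ℤ :=
  { a₁ := 0, a₂ := 0, a₃ := 0, a₄ := 0, a₆ := -(2 ^ 4 * 3 ^ 7) }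

theorem nonsingular_P0 : (E9⁄ℚ).Nonsingular 36 108 := by
  rw [nonsingular_iff, equation_iff]
  simp only [E9, baseChange, WeierstrassCurve.baseChange, WeierstrassCurve.map]
  norm_num

/-- The point `P₀ = (36, 108)` of `E₉(ℚ)`. -/
def P0 : (E9⁄ℚ).Point := .some 36 108 nonsingular_P0

/-- The affine coordinates of a point (no coordinates for the point at infinity). -/
def coords {F : Type*} [Field F] {W : WeierstrassCurve.Affine F} : W.Point → Set F
  | .zero => ∅
  | .some x y _ => {x, y}

open scoped Classical in
/-- The field `ℚ(A, E₉[3])`, generated over `ℚ` by the coordinates of `A` and of all the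
`3`-torsion points of `E₉` over the algebraic closure of `ℚ`. -/
def fieldOfPointAndThreeTorsion (A : (E9⁄(AlgebraicClosure ℚ)).Point) :
    IntermediateField ℚ (AlgebraicClosure ℚ) :=
  IntermediateField.adjoin ℚ
    (coords A ∪ ⋃ T ∈ {T : (E9⁄(AlgebraicClosure ℚ)).Point | (3 : ℕ) • T = 0}, coords T)

/-- The imaginary quadratic field `K = ℚ(√-3)`, inside `ℂ`. -/
abbrev K : IntermediateField ℚ ℂ :=
  IntermediateField.adjoin ℚ {((Real.sqrt 3 : ℝ) : ℂ) * Complex.I}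

instance : FiniteDimensional ℚ K := by
  refine IntermediateField.adjoin.finiteDimensional ?_
  refine ⟨Polynomial.X ^ 2 + Polynomial.C 3, by monicity!, ?_⟩
  have h : ((Real.sqrt 3 : ℝ) : ℂ) ^ 2 = 3 := by
    rw [← Complex.ofReal_pow, Real.sq_sqrt (by norm_num)]; norm_num
  simp [mul_pow, h]

instance : NumberField K where

section Reduction

variable (p : ℕ) [Fact p.Prime]

theorem equation_toZMod {W : WeierstrassCurve.Affine ℤ} {x y : ℤ_[p]}
    (h : (W⁄ℚ_[p]).Equation (x : ℚ_[p]) (y : ℚ_[p])) :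
    (W⁄(ZMod p)).Equation (PadicInt.toZMod x) (PadicInt.toZMod y) := by
  rw [equation_iff] at h ⊢
  simp only [baseChange, WeierstrassCurve.baseChange, WeierstrassCurve.map, algebraMap_int_eq, eq_intCast] at h ⊢
  have h' : y ^ 2 + W.a₁ * x * y + W.a₃ * y = x ^ 3 + W.a₂ * x ^ 2 + W.a₄ * x + W.a₆ := by
    apply PadicInt.ext
    push_cast
    exact h
  simpa using congrArg (PadicInt.toZMod (p := p)) h'

open scoped Classical in
/-- Reduction modulo a prime `p` of good reduction, `W(ℚ_p) → W(𝔽_p)`, for a Weierstrass equation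
`W` over `ℤ`: a point with coordinates in `ℤ_p` is reduced coordinatewise, and every other point
goes to the point at infinity. -/
def reduction {W : WeierstrassCurve.Affine ℤ} (hW : (W⁄(ZMod p)).Δ ≠ 0) :
    (W⁄ℚ_[p]).Point → (W⁄(ZMod p)).Point
  | .zero => 0
  | .some x y h =>
    if hxy : ‖x‖ ≤ 1 ∧ ‖y‖ ≤ 1 then
      .some (PadicInt.toZMod (⟨x, hxy.1⟩ : ℤ_[p])) (PadicInt.toZMod (⟨y, hxy.2⟩ : ℤ_[p]))
        ((equation_iff_nonsingular_of_Δ_ne_zero hW).mp (equation_toZMod p h.1))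
    else 0

variable {p}

/-- `E₉` has good reduction at every odd prime `p ≡ 2, 5 mod 9`. -/
theorem E9_disc_ne_zero (hp : p ≠ 2) (hp9 : p % 9 = 2 ∨ p % 9 = 5) : (E9⁄(ZMod p)).Δ ≠ 0 := by
  have hpp : p.Prime := Fact.out
  have hp3 : p ≠ 3 := by rintro rfl; omega
  have h2 : (2 : ZMod p) ≠ 0 := by
    intro h
    have h' : ((2 : ℕ) : ZMod p) = 0 := by exact_mod_cast h
    rw [ZMod.natCast_eq_zero_iff] at h'
    exact hp ((Nat.prime_dvd_prime_iff_eq hpp Nat.prime_two).mp h')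
  have h3 : (3 : ZMod p) ≠ 0 := by
    intro h
    have h' : ((3 : ℕ) : ZMod p) = 0 := by exact_mod_cast h
    rw [ZMod.natCast_eq_zero_iff] at h'
    exact hp3 ((Nat.prime_dvd_prime_iff_eq hpp Nat.prime_three).mp h')
  have h : (E9⁄(ZMod p)).Δ = -(2 ^ 12 * 3 ^ 17) := by
    simp only [WeierstrassCurve.Δ, WeierstrassCurve.b₂, WeierstrassCurve.b₄, WeierstrassCurve.b₆,
      WeierstrassCurve.b₈, E9, baseChange, WeierstrassCurve.baseChange, WeierstrassCurve.map,
      algebraMap_int_eq, eq_intCast]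
    push_cast
    ring
  rw [h]
  exact neg_ne_zero.mpr (mul_ne_zero (pow_ne_zero _ h2) (pow_ne_zero _ h3))

end Reduction

/-- The `ℓ`-component of the element `P` of an abelian group is nontrivial: `P = Q + R` with
`Q ≠ 0` killed by a power of `ℓ` and `R` of finite order prime to `ℓ`. -/
def HasNontrivialComponent {G : Type*} [AddCommGroup G] (ℓ : ℕ) (P : G) : Prop :=
  ∃ Q R : G, P = Q + R ∧ (∃ k : ℕ, ℓ ^ k • Q = 0) ∧ Nat.Coprime ℓ (addOrderOf R) ∧ Q ≠ 0

end CubeSum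

end

open scoped WeierstrassCurve.Affine

namespace CubeSum

open WeierstrassCurve.Affine

/-! ### The Kummer function `y - s` on `E9` -/

section Curve

variable {F : Type*} [Field F] [Algebra ℤ F]

/-! Let `s ^ 2 = -34992`, so `s = 108√-3`. The function `y - s` has divisor `3(0, s) - 3(O)`, hence
gives a homomorphism to the multiplicative group modulo cubes, which kills multiples of 3
(`addY_sub_mul_cube`, `exists_cube_of_three_nsmul`). At `P0` its value is `108 - s = (-6)³ w` with
`w` a primitive cube root of unity.

If `3 • A = P0`, then `w` is a cube in the field of `A` and `s`, which therefore contains a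
primitive ninth root of unity; as `(0, s)` is 3-torsion, this is part 1. Over `p`, the residue field
of `K` satisfies `z ^ p ^ 2 = z`, and `9 ∤ p ^ 2 - 1`, so `w` is not a cube there
(`omega_pow_ne_cube`). This excludes division by 3 in the completion and in `E9(𝔽_p)`, and in a
finite group it yields the 3-component.

For `m` prime to 3, `m • P0` has class `w ^ m` (`kummer_nsmul_P0`). A point reducing to `O` has
class that of a unit congruent to 1, which `cube_mul_ne` forbids. -/

theorem E9_a₁ : (E9⁄F).a₁ = 0 := by simp [E9, baseChange, WeierstrassCurve.baseChange]
theorem E9_a₂ : (E9⁄F).a₂ = 0 := by simp [E9, baseChange, WeierstrassCurve.baseChange]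
theorem E9_a₃ : (E9⁄F).a₃ = 0 := by simp [E9, baseChange, WeierstrassCurve.baseChange]
theorem E9_a₄ : (E9⁄F).a₄ = 0 := by simp [E9, baseChange, WeierstrassCurve.baseChange]
theorem E9_a₆ : (E9⁄F).a₆ = -34992 := by
  simp [E9, baseChange, WeierstrassCurve.baseChange]

theorem E9_equation_iff (x y : F) : (E9⁄F).Equation x y ↔ y ^ 2 = x ^ 3 - 34992 := by
  rw [equation_iff, E9_a₁, E9_a₂, E9_a₃, E9_a₄, E9_a₆]; ring_nf

theorem E9_negY (x y : F) : (E9⁄F).negY x y = -y := by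
  simp only [negY, E9_a₁, E9_a₃]; ring

theorem E9_addX (x₁ x₂ ℓ : F) : (E9⁄F).addX x₁ x₂ ℓ = ℓ ^ 2 - x₁ - x₂ := by
  simp only [addX, E9_a₁, E9_a₂]; ring

theorem E9_addY (x₁ x₂ y₁ ℓ : F) :
    (E9⁄F).addY x₁ x₂ y₁ ℓ = -(ℓ * ((E9⁄F).addX x₁ x₂ ℓ - x₁) + y₁) := by
  rw [addY, E9_negY, negAddY]

/-- The Kummer function `y - s`, for `s` a square root of `-34992`, is multiplicative up to cubes
along a chord or tangent. -/
theorem addY_sub_mul_cube [DecidableEq F] {x₁ x₂ y₁ y₂ s : F} (h₁ : (E9⁄F).Equation x₁ y₁)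
    (h₂ : (E9⁄F).Equation x₂ y₂) (hxy : ¬(x₁ = x₂ ∧ y₁ = (E9⁄F).negY x₂ y₂))
    (hs : s ^ 2 = -34992) :
    ((E9⁄F).addY x₁ x₂ y₁ ((E9⁄F).slope x₁ x₂ y₁ y₂) - s) *
        (y₁ - (E9⁄F).slope x₁ x₂ y₁ y₂ * x₁ - s) ^ 3 =
      -((y₁ - s) * (y₂ - s) *
        (E9⁄F).addX x₁ x₂ ((E9⁄F).slope x₁ x₂ y₁ y₂) ^ 3) := by
  have hline : y₂ = (E9⁄F).slope x₁ x₂ y₁ y₂ * (x₂ - x₁) + y₁ := by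
    by_cases hx : x₁ = x₂
    · subst hx
      have := Y_eq_of_Y_ne h₁ h₂ rfl (fun h => hxy ⟨rfl, h⟩)
      rw [← this]; ring
    · rw [slope_of_X_ne hx]
      have := sub_ne_zero.mpr hx
      field_simp
      ring
  have h₃ := (E9_equation_iff _ _).mp (equation_add h₁ h₂ hxy)
  have key := addPolynomial_slope h₁ h₂ hxy
  set ℓ := (E9⁄F).slope x₁ x₂ y₁ y₂
  have hy₃ : (E9⁄F).addY x₁ x₂ y₁ ℓ = -(ℓ * ((E9⁄F).addX x₁ x₂ ℓ - x₁) + y₁) :=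
    E9_addY ..
  set x₃ := (E9⁄F).addX x₁ x₂ ℓ
  set y₃ := (E9⁄F).addY x₁ x₂ y₁ ℓ
  -- The line meets the curve at abscissae `x₁`, `x₂`, `x₃`.
  have key' : ∀ t : F, (ℓ * (t - x₁) + y₁) ^ 2 - t ^ 3 + 34992 =
      -((t - x₁) * (t - x₂) * (t - x₃)) := by
    intro t
    have := congrArg (Polynomial.eval t) key
    rw [addPolynomial_eq, E9_a₁, E9_a₂, E9_a₃, E9_a₄, E9_a₆] at this
    simp [Cubic.toPoly] at this
    linear_combination this
  have hprod : (y₁ - s) * (y₂ - s) * (-y₃ - s) = (y₁ - ℓ * x₁ - s) ^ 3 := by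
    by_cases hℓ : ℓ = 0
    · rw [hy₃, hline, hℓ]; ring
    -- `t` is the abscissa where the line meets `y = s`; there the left side of `key'` is `-t ^ 3`.
    · obtain ⟨t, ht⟩ : ∃ t, ℓ * t = -(y₁ - ℓ * x₁ - s) := ⟨_ / ℓ, mul_div_cancel₀ _ hℓ⟩
      have h := key' t
      have ht₁ : y₁ - s = -(ℓ * (t - x₁)) := by linear_combination ht
      have ht₂ : y₂ - s = -(ℓ * (t - x₂)) := by linear_combination ht + hline
      have ht₃ : -y₃ - s = -(ℓ * (t - x₃)) := by linear_combination ht - hy₃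
      have ht' : ℓ * (t - x₁) + y₁ = s := by linear_combination ht
      rw [ht', hs] at h
      rw [ht₁, ht₂, ht₃, ← neg_neg (y₁ - ℓ * x₁ - s), ← ht]
      linear_combination -ℓ ^ 3 * h
  rw [← hprod]
  -- `(y₃ - s)(-y₃ - s) = s² - y₃² = -x₃³`.
  linear_combination (-(y₁ - s) * (y₂ - s)) * (h₃ - hs)

/-- The Kummer function at `3 • (x, y)` is a cube. -/
theorem exists_cube_of_three_nsmul [DecidableEq F] (hF2 : (2 : F) ≠ 0) (hF3 : (3 : F) ≠ 0)
    {A : (E9⁄F).Point} {X Y s : F} {h : (E9⁄F).Nonsingular X Y} (hY : Y ≠ 0)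
    (hs : s ^ 2 = -34992) (hA : (3 : ℕ) • A = .some X Y h) :
    ∃ (x y : F) (hxy : (E9⁄F).Nonsingular x y), A = .some x y hxy ∧
      Y - s = ((y * (x ^ 3 + 8 * 34992) / x ^ 3 - 9 * s) /
        (3 * ((x ^ 3 - 4 * 34992) / x ^ 2))) ^ 3 := by
  rcases A with _ | ⟨x, y, hxy⟩
  · rw [← Point.zero_def, smul_zero] at hA
    exact absurd hA.symm (Point.some_ne_zero h)
  refine ⟨x, y, hxy, rfl, ?_⟩
  have he := (E9_equation_iff x y).mp hxy.1
  have hy : y ≠ 0 := by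
    rintro rfl
    have h2 : Point.some x 0 hxy + Point.some x 0 hxy = 0 :=
      Point.add_self_of_Y_eq (by rw [E9_negY, neg_zero])
    rw [succ_nsmul, two_nsmul, h2, zero_add, Point.some.injEq] at hA
    exact hY hA.2.symm
  have hyn : y ≠ (E9⁄F).negY x y := by
    rw [E9_negY]
    intro e
    have : 2 * y = 0 := by linear_combination e
    simp [hF2, hy] at this
  obtain ⟨x₂, y₂, h₂, hdbl, hx₂, hy₂⟩ : ∃ (x₂ y₂ : F) (h₂ : (E9⁄F).Nonsingular x₂ y₂),
      Point.some x y hxy + Point.some x y hxy = .some x₂ y₂ h₂ ∧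
      x₂ = x - (3 * x * (x ^ 3 - 4 * 34992)) / (2 * y) ^ 2 ∧
      y₂ = -(3 * x ^ 2 / (2 * y) * (x₂ - x) + y) := by
    have hℓ : (E9⁄F).slope x x y y = 3 * x ^ 2 / (2 * y) := by
      rw [slope_of_Y_ne rfl hyn, E9_negY, E9_a₁, E9_a₂, E9_a₄]; ring
    refine ⟨_, _, _, Point.add_self_of_Y_ne hyn, ?_, by rw [E9_addY, hℓ]⟩
    rw [E9_addX, hℓ]
    field_simp
    linear_combination (-12 * x) * he
  rw [succ_nsmul, two_nsmul, hdbl] at hA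
  have hxx : x₂ ≠ x := by
    intro hxx
    rcases Point.X_eq_iff (h₁ := h₂) (h₂ := hxy) |>.mp hxx with h' | h'
    · rw [h', add_eq_left] at hdbl
      exact Point.some_ne_zero _ hdbl
    · rw [h', neg_add_cancel] at hA
      exact Point.some_ne_zero _ hA.symm
  rw [Point.add_of_X_ne hxx, Point.some.injEq] at hA
  -- Up to the factor 3 this is the 3-division polynomial; at its zeros `2A` and `A` share an
  -- abscissa.
  have hprod : x * (x ^ 3 - 4 * 34992) ≠ 0 := by
    intro h0
    apply hxx
    rw [hx₂, mul_assoc 3, h0]; simp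
  obtain ⟨hx0, hd0⟩ := mul_ne_zero_iff.mp hprod
  have hℓ : (E9⁄F).slope x₂ x y₂ y =
      -(3 * x ^ 2 / (2 * y)) + 8 * y ^ 3 / (3 * x * (x ^ 3 - 4 * 34992)) := by
    rw [slope_of_X_ne hxx, div_eq_iff (sub_ne_zero.mpr hxx), hy₂, hx₂]
    field_simp
    ring
  rw [← hA.2, E9_addY, E9_addX, hℓ, hy₂, hx₂]
  -- Eliminating the constant as `x ^ 3 - y ^ 2` absorbs the curve equation and leaves a rational
  -- identity.
  obtain ⟨c, hc⟩ : ∃ c : F, c = 34992 := ⟨_, rfl⟩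
  rw [← hc] at hs he hd0 ⊢
  obtain rfl : c = x ^ 3 - y ^ 2 := by linear_combination he
  clear * - hs hx0 hd0 hy hF2 hF3
  -- For `a = y(x³ + 8c)/x³` and `b = (x³ - 4c)/x²`, `(b, a)` is the image of `A` under the
  -- 3-isogeny to `Y² = X³ + 27c`. The cube of `(a - 9s)/(3b)` is `a(a² - 243c)/(27b³) - s`, and the
  -- first term is the ordinate of `3A` given by the dual isogeny.
  have hcube (a : F) : (a - 9 * s) ^ 3 = a ^ 3 + 243 * (y ^ 2 - x ^ 3) * a -
      s * (27 * a ^ 2 + 729 * (y ^ 2 - x ^ 3)) := by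
    linear_combination (243 * a - 729 * s) * hs
  rw [div_pow, hcube]
  field_simp
  ring

end Curve

/-! ### Cube roots of a primitive cube root of unity -/

section NinthRoots

variable {F : Type*} [Field F]

theorem omega_pow_three {w : F} (hw : w ^ 2 + w + 1 = 0) : w ^ 3 = 1 := by
  linear_combination (w - 1) * hw

theorem omega_ne_one (h3 : (3 : F) ≠ 0) {w : F} (hw : w ^ 2 + w + 1 = 0) : w ≠ 1 := by
  rintro rfl
  exact h3 (by linear_combination hw)

/-- As `34992 = 3 · 108²`, `w` is `(-1 + √-3)/2`. -/
theorem omega_of_sq_eq (h2 : (2 : F) ≠ 0) (h3 : (3 : F) ≠ 0) {s w : F} (hs : s ^ 2 = -34992)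
    (hw : 216 * w = s - 108) : w ^ 2 + w + 1 = 0 := by
  have h : (216 : F) ^ 2 ≠ 0 := by
    rw [show (216 : F) ^ 2 = 2 ^ 6 * 3 ^ 6 by norm_num]
    exact mul_ne_zero (pow_ne_zero _ h2) (pow_ne_zero _ h3)
  refine mul_left_cancel₀ h ?_
  linear_combination hs + (216 * w + s - 108 + 216) * hw

/-- If `108 - s` is a cube, then its cube root divided by `-6` is a cube root of `w`. -/
theorem omega_eq_cube (h2 : (2 : F) ≠ 0) (h3 : (3 : F) ≠ 0) {s u w : F}
    (hw : 216 * w = s - 108) (hu : 108 - s = u ^ 3) : (-u / 6) ^ 3 = w := by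
  have h6 : (6 : F) ≠ 0 := by
    rw [show (6 : F) = 2 * 3 by norm_num]; exact mul_ne_zero h2 h3
  rw [div_pow, div_eq_iff (pow_ne_zero _ h6)]
  linear_combination hu - hw

theorem isPrimitiveRoot_nine (h3 : (3 : F) ≠ 0) {w z : F} (hw : w ^ 2 + w + 1 = 0)
    (hz : z ^ 3 = w) : IsPrimitiveRoot z 9 := by
  have h9 : z ^ 3 ^ (1 + 1) = 1 := by
    rw [← omega_pow_three hw, ← hz]; ring
  have h3' : ¬ z ^ 3 ^ 1 = 1 := by
    rw [pow_one, hz]; exact omega_ne_one h3 hw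
  have := orderOf_eq_prime_pow h3' h9
  rw [show (9 : ℕ) = 3 ^ (1 + 1) by norm_num, ← this]
  exact IsPrimitiveRoot.orderOf z

/-- In a field fixed by the `p ^ 2`-power map, with `9 ∤ p ^ 2 - 1`, a primitive cube root of unity
is not a cube, and neither is its inverse. -/
theorem omega_pow_ne_cube (h3 : (3 : F) ≠ 0) {p : ℕ} (hp9 : p % 9 = 2 ∨ p % 9 = 5)
    (hF : ∀ z : F, z ^ p ^ 2 = z) {w : F} (hw : w ^ 2 + w + 1 = 0) {n : ℕ} (hn : ¬ 3 ∣ n) (z : F) :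
    z ^ 3 ≠ w ^ n := by
  intro hz
  have hw3 := omega_pow_three hw
  have hz9 : z ^ 9 = 1 := by
    rw [show 9 = 3 * 3 by norm_num, pow_mul, hz, ← pow_mul, mul_comm, pow_mul, hw3, one_pow]
  have hz0 : z ≠ 0 := by rintro rfl; norm_num at hz9
  have hz3 : z ^ 3 = 1 := by
    have hzp := hF z
    rw [← Nat.mod_add_div (p ^ 2) 9, pow_add, pow_mul, hz9, one_pow, mul_one] at hzp
    -- Since `z ^ 9 = 1`, only `p ^ 2` modulo 9 matters: `z ^ 4 = z` or `z ^ 7 = z`, and either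
    -- gives `z ^ 3 = 1`.
    have : p ^ 2 % 9 = 4 ∨ p ^ 2 % 9 = 7 := by
      rcases hp9 with h | h <;> simp [Nat.pow_mod, h]
    rcases this with h | h <;> rw [h] at hzp
    · exact mul_left_cancel₀ hz0 (by linear_combination hzp)
    · have h6 : z ^ 6 = 1 := mul_left_cancel₀ hz0 (by linear_combination hzp)
      linear_combination hz9 - z ^ 3 * h6
  rw [hz3] at hz
  have h1 : orderOf w ∣ n := orderOf_dvd_of_pow_eq_one hz.symm
  rw [orderOf_eq_prime hw3 (omega_ne_one h3 hw)] at h1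
  exact hn h1

end NinthRoots

/-! ### Ninth roots of unity in the 3-division field -/

section Division

theorem P0_eq_map {F : Type*} [Field F] [Algebra ℤ F] [Algebra ℚ F] [DecidableEq F]
    [@IsScalarTower ℤ ℚ F Algebra.toSMul Algebra.toSMul Algebra.toSMul] :
    ∃ h, Point.baseChange ℚ F P0 = .some 36 108 h := by
  have h : (E9⁄F).Nonsingular 36 108 := by
    have := (E9.baseChange_nonsingular (Algebra.ofId ℚ F).injective 36 108).mpr nonsingular_P0
    simpa using this
  refine ⟨h, ?_⟩
  rw [P0, Point.baseChange, Point.map_some, Point.some.injEq]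
  simp

open scoped Classical in
-- `(0, s)` is a flex: its tangent `y = s` meets the curve where `x ^ 3 = 0`.
theorem three_nsmul_of_X_eq_zero {F : Type*} [Field F] [Algebra ℤ F] (h2 : (2 : F) ≠ 0) {s : F}
    (hs0 : s ≠ 0) (h : (E9⁄F).Nonsingular 0 s) : (3 : ℕ) • Point.some 0 s h = 0 := by
  have hyn : s ≠ (E9⁄F).negY 0 s := by
    rw [E9_negY]
    intro e
    have : 2 * s = 0 := by linear_combination e
    simp [h2, hs0] at this
  have hℓ : (E9⁄F).slope 0 0 s s = 0 := by
    rw [slope_of_Y_ne rfl hyn, E9_negY, E9_a₁, E9_a₂, E9_a₄]; simp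
  have hdbl : Point.some 0 s h + Point.some 0 s h = -Point.some 0 s h := by
    rw [Point.add_self_of_Y_ne hyn, Point.neg_some, Point.some.injEq]
    rw [E9_addY, E9_addX, hℓ, E9_negY]; simp
  rw [succ_nsmul, two_nsmul, hdbl, neg_add_cancel]

open scoped Classical in
theorem adjoin_zeta_nine_le (ι : AlgebraicClosure ℚ →ₐ[ℚ] ℂ) (A : (E9⁄(AlgebraicClosure ℚ)).Point)
    (hA : (3 : ℕ) • A = Point.baseChange ℚ (AlgebraicClosure ℚ) P0) :
    IntermediateField.adjoin ℚ {Complex.exp (2 * Real.pi * Complex.I / 9)} ≤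
      (fieldOfPointAndThreeTorsion A).map ι := by
  rw [IntermediateField.adjoin_simple_le_iff]
  obtain ⟨s, hs⟩ := IsAlgClosed.exists_pow_nat_eq (-34992 : AlgebraicClosure ℚ) (n := 2) two_pos
  have h2 : (2 : AlgebraicClosure ℚ) ≠ 0 := two_ne_zero
  have h3 : (3 : AlgebraicClosure ℚ) ≠ 0 := three_ne_zero
  have hs0 : s ≠ 0 := by rintro rfl; norm_num at hs
  obtain ⟨h0, hP0⟩ := P0_eq_map (F := AlgebraicClosure ℚ)
  rw [hP0] at hA
  obtain ⟨x, y, hxy, rfl, hu⟩ := exists_cube_of_three_nsmul h2 h3 (by norm_num) hs hA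
  set E := fieldOfPointAndThreeTorsion (Point.some x y hxy)
  have hx : x ∈ E := IntermediateField.subset_adjoin _ _ (Or.inl (Or.inl rfl))
  have hy : y ∈ E := IntermediateField.subset_adjoin _ _ (Or.inl (Or.inr rfl))
  have hsE : s ∈ E := by
    have hT : (E9⁄(AlgebraicClosure ℚ)).Nonsingular 0 s := by
      rw [nonsingular_iff, E9_equation_iff, ← negY, E9_negY]
      refine ⟨by linear_combination hs, Or.inr fun h => hs0 ?_⟩
      exact self_eq_neg.mp h
    refine IntermediateField.subset_adjoin _ _ (Or.inr (Set.mem_biUnion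
      (three_nsmul_of_X_eq_zero h2 hs0 hT) (Or.inr rfl)))
  set u := (y * (x ^ 3 + 8 * 34992) / x ^ 3 - 9 * s) / (3 * ((x ^ 3 - 4 * 34992) / x ^ 2))
  have hn (n : ℕ) : (n : AlgebraicClosure ℚ) ∈ E := natCast_mem E n
  have huE : u ∈ E := by
    refine div_mem (sub_mem (div_mem (mul_mem hy (add_mem (pow_mem hx 3) ?_)) (pow_mem hx 3))
      (mul_mem (hn 9) hsE)) (mul_mem (hn 3) (div_mem (sub_mem (pow_mem hx 3) ?_) (pow_mem hx 2)))
    · exact_mod_cast hn (8 * 34992)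
    · exact_mod_cast hn (4 * 34992)
  have hw : 216 * ((s - 108) / 216) = s - 108 := mul_div_cancel₀ _ (by norm_num)
  have hprim : IsPrimitiveRoot (-u / 6) 9 :=
    isPrimitiveRoot_nine h3 (omega_of_sq_eq h2 h3 hs hw) (omega_eq_cube h2 h3 hw hu)
  have hprim' := hprim.map_of_injective ι.injective
  -- Whichever primitive ninth root `ι` produces, `exp (2πi/9)` is a power of it.
  obtain ⟨i, -, hi⟩ := hprim'.eq_pow_of_pow_eq_one
    (Complex.isPrimitiveRoot_exp 9 (by norm_num)).pow_eq_one
  have hmem : (-u / 6) ^ i ∈ E := pow_mem (div_mem (neg_mem huE) (hn 6)) i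
  refine ⟨_, hmem, ?_⟩
  simpa using hi

end Division

/-! ### Residue fields of `K` above `p` -/

section Local

open IsDedekindDomain HeightOneSpectrum NumberField

section ResidueField

variable {R : Type*} [CommRing R] [IsDedekindDomain R] {L : Type*} [Field L] [Algebra R L]
  [IsFractionRing R L] (v : HeightOneSpectrum R)

theorem residue_eq_zero_iff (x : v.adicCompletionIntegers L) :
    IsLocalRing.residue (v.adicCompletionIntegers L) x = 0 ↔
      Valued.v (x : v.adicCompletion L) < 1 := by
  rw [IsLocalRing.residue_eq_zero_iff]
  exact Valuation.mem_maximalIdeal_iff _ _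

/-- `L` is dense in its completion, and a `v`-integral element of `L` is congruent to an element of
`R`. -/
theorem residue_algebraMap_surjective : Function.Surjective
    ((IsLocalRing.residue (v.adicCompletionIntegers L)).comp
      (algebraMap R (v.adicCompletionIntegers L))) := by
  intro z
  obtain ⟨z, rfl⟩ := IsLocalRing.residue_surjective z
  have hopen : IsOpen {x : v.adicCompletion L | Valued.v (x - z) < 1} := by
    have h := (Valued.isOpen_ball (v.adicCompletion L) 1).preimage
      (continuous_sub_right (z : v.adicCompletion L))
    simp only [Valuation.restrict_lt_one_iff] at h
    exact h
  obtain ⟨k, hk⟩ := (denseRange_algebraMap L v).exists_mem_open hopen ⟨z, by simp⟩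
  have hk1 : v.valuation L k ≤ 1 := by
    rw [← valuedAdicCompletion_eq_valuation']
    have := Valued.v.map_add_le (le_of_lt hk) ((mem_adicCompletionIntegers _ _ _).mp z.2)
    rwa [sub_add_cancel] at this
  obtain ⟨a, ha⟩ := exists_valuation_sub_lt_of_integer v hk1 1
  refine ⟨a, ?_⟩
  rw [← sub_eq_zero, RingHom.comp_apply, ← map_sub, residue_eq_zero_iff]
  rw [← valuedAdicCompletion_eq_valuation'] at ha
  have := Valued.v.map_add_lt ha hk
  have hcast : ((algebraMap R (v.adicCompletionIntegers L) a - z : v.adicCompletionIntegers L) :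
      v.adicCompletion L) = algebraMap L (v.adicCompletion L) (algebraMap R L a - k) +
        (algebraMap L (v.adicCompletion L) k - z) := by
    rw [map_sub, sub_add_sub_cancel]
    rfl
  rw [hcast]
  exact this

theorem residue_algebraMap_eq_zero_iff (a : R) :
    IsLocalRing.residue (v.adicCompletionIntegers L)
      (algebraMap R (v.adicCompletionIntegers L) a) = 0 ↔ a ∈ v.asIdeal := by
  rw [residue_eq_zero_iff, ← valuation_lt_one_iff_mem (K := L),
    ← valuedAdicCompletion_eq_valuation']
  rfl

end ResidueField

theorem finrank_K_le : Module.finrank ℚ K ≤ 2 := by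
  have h3 : ((Real.sqrt 3 : ℝ) : ℂ) ^ 2 = 3 := by
    rw [← Complex.ofReal_pow, Real.sq_sqrt (by norm_num)]; norm_num
  have hmonic : (Polynomial.X ^ 2 + Polynomial.C 3 : Polynomial ℚ).Monic := by monicity!
  have hroot : Polynomial.aeval (((Real.sqrt 3 : ℝ) : ℂ) * Complex.I)
      (Polynomial.X ^ 2 + Polynomial.C 3 : Polynomial ℚ) = 0 := by simp [mul_pow, h3]
  rw [IntermediateField.adjoin.finrank ⟨_, hmonic, hroot⟩]
  refine (Polynomial.natDegree_le_natDegree (minpoly.min ℚ _ hmonic hroot)).trans ?_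
  compute_degree

/-- The norm of `v` divides that of `(p)`, namely `p ^ [K : ℚ]`, so the residue field has `p ^ i`
elements with `i ≤ 2`. This bound suffices; inertness of `p` plays no role. -/
theorem residue_pow_sq (v : HeightOneSpectrum (𝓞 K)) {p : ℕ} (hp : p.Prime)
    (hv : (p : 𝓞 K) ∈ v.asIdeal) (z : IsLocalRing.ResidueField (v.adicCompletionIntegers K)) :
    z ^ p ^ 2 = z := by
  obtain ⟨a, rfl⟩ := residue_algebraMap_surjective v z
  have : v.asIdeal.IsMaximal := v.isMaximal
  let _ : Field (𝓞 K ⧸ v.asIdeal) := Ideal.Quotient.field _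
  let _ : Fintype (𝓞 K ⧸ v.asIdeal) := Fintype.ofFinite _
  have hcard : Fintype.card (𝓞 K ⧸ v.asIdeal) ∣ p ^ 2 := by
    have h1 : Ideal.absNorm v.asIdeal ∣ Ideal.absNorm (Ideal.span {(p : 𝓞 K)}) :=
      Ideal.absNorm_dvd_absNorm_of_le ((Ideal.span_singleton_le_iff_mem _).mpr hv)
    rw [Ideal.absNorm_span_natCast, RingOfIntegers.rank] at h1
    rw [← Nat.card_eq_fintype_card]
    exact h1.trans (pow_dvd_pow p finrank_K_le)
  obtain ⟨i, hi, hi'⟩ := (Nat.dvd_prime_pow hp).mp hcard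
  have hfix (b : 𝓞 K ⧸ v.asIdeal) : b ^ p ^ i = b := by
    rw [← hi']; exact FiniteField.pow_card b
  have hfix2 (b : 𝓞 K ⧸ v.asIdeal) : b ^ p ^ 2 = b := by
    interval_cases i
    · rw [pow_zero] at hi'
      exact absurd Fintype.one_lt_card hi'.not_gt
    · rw [pow_one] at hfix
      rw [sq, pow_mul, hfix, hfix]
    · exact hfix b
  have hmem : a ^ p ^ 2 - a ∈ v.asIdeal := by
    rw [← Ideal.Quotient.eq_zero_iff_mem, map_sub, map_pow, hfix2, sub_self]
  rw [← residue_algebraMap_eq_zero_iff (L := K), map_sub, map_sub, map_pow, map_pow,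
    sub_eq_zero] at hmem
  exact hmem

theorem exists_sq_eq : ∃ s : K, s ^ 2 = -34992 := by
  refine ⟨⟨108 * (((Real.sqrt 3 : ℝ) : ℂ) * Complex.I),
    mul_mem (natCast_mem K 108) (IntermediateField.mem_adjoin_simple_self _ _)⟩, ?_⟩
  have h : ((Real.sqrt 3 : ℝ) : ℂ) ^ 2 = 3 := by
    rw [← Complex.ofReal_pow, Real.sq_sqrt (by norm_num)]; norm_num
  apply Subtype.ext
  push_cast
  rw [mul_pow, mul_pow, h, Complex.I_sq]
  norm_num
  rfl

theorem exists_heightOneSpectrum {p : ℕ} (hp : p.Prime) :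
    ∃ v : HeightOneSpectrum (𝓞 K), (p : 𝓞 K) ∈ v.asIdeal := by
  have hnu : ¬ IsUnit (p : 𝓞 K) := by
    intro h
    have h1 := Ideal.absNorm_span_natCast (S := 𝓞 K) p
    rw [Ideal.span_singleton_eq_top.mpr h, Ideal.absNorm_top, RingOfIntegers.rank] at h1
    exact (Nat.one_lt_pow Module.finrank_pos.ne' hp.one_lt).ne h1
  obtain ⟨M, hM, hpM⟩ := exists_max_ideal_of_mem_nonunits hnu
  refine ⟨⟨M, hM.isPrime, ?_⟩, hpM⟩
  rintro rfl
  rw [Ideal.mem_bot, Nat.cast_eq_zero] at hpM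
  exact hp.ne_zero hpM

theorem natCast_residue_ne_zero (v : HeightOneSpectrum (𝓞 K)) {p q : ℕ} (hpq : p.Coprime q)
    (hv : (p : 𝓞 K) ∈ v.asIdeal) :
    (q : IsLocalRing.ResidueField (v.adicCompletionIntegers K)) ≠ 0 := by
  intro h
  rw [← map_natCast ((IsLocalRing.residue (v.adicCompletionIntegers K)).comp
      (algebraMap (𝓞 K) (v.adicCompletionIntegers K))), RingHom.comp_apply,
      residue_algebraMap_eq_zero_iff] at h
  apply v.isPrime.ne_top
  rw [Ideal.eq_top_iff_one]
  obtain ⟨a, b, hab⟩ := Nat.isCoprime_iff_coprime.mpr hpq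
  have : (1 : 𝓞 K) = a * p + b * q := by exact_mod_cast (congrArg (Int.cast (R := 𝓞 K)) hab).symm
  rw [this]
  exact add_mem (Ideal.mul_mem_left _ _ hv) (Ideal.mul_mem_left _ _ h)

end Local

/-! ### Kummer classes of the multiples of `P0` -/

section KummerClass

/-- It ensures that `y - s` does not vanish at rational points and that no rational point has
abscissa 0. -/
theorem rat_sq_ne (y : ℚ) : y ^ 2 ≠ -34992 := by
  intro h
  nlinarith [sq_nonneg y]

variable {L : Type*} [Field L] [Algebra ℤ L] [Algebra ℚ L] [DecidableEq L]
  [@IsScalarTower ℤ ℚ L Algebra.toSMul Algebra.toSMul Algebra.toSMul]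

/-- The Kummer class of `n • P₀` is that of `w ^ n`, where `w = (s - 108) / 216` is a primitive cube
root of unity. -/
theorem kummer_nsmul_P0 {s w : L} (hs : s ^ 2 = -34992) (hw : 216 * w = s - 108) (n : ℕ) :
    (n • P0 = 0 → ∃ u : L, u ^ 3 = w ^ n) ∧
    ∀ x y h, n • P0 = .some x y h → ∃ u : L, algebraMap ℚ L y - s = w ^ n * u ^ 3 := by
  have hchar : CharZero L := algebraRat.charZero L
  have hs' (y : ℚ) : algebraMap ℚ L y - s ≠ 0 := by
    intro h
    apply rat_sq_ne y
    apply (algebraMap ℚ L).injective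
    rw [map_pow, sub_eq_zero.mp h, hs]; simp
  have hw2 : w ^ 2 + w + 1 = 0 := omega_of_sq_eq two_ne_zero three_ne_zero hs hw
  have hw0 : w ≠ 0 := by rintro rfl; norm_num at hw2
  obtain ⟨hP, hP0⟩ := P0_eq_map (F := L)
  induction n with
  | zero => exact ⟨fun _ => ⟨1, by simp⟩, fun x y h h0 =>
      absurd ((zero_nsmul P0).symm.trans h0).symm (Point.some_ne_zero h)⟩
  | succ n ih =>
    rw [succ_nsmul]
    rcases hn : n • P0 with _ | ⟨x₁, y₁, h₁⟩
    · obtain ⟨c, hc⟩ := ih.1 hn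
      have hc0 : c ≠ 0 := by
        rintro rfl
        exact pow_ne_zero n hw0 (by rw [← hc]; norm_num)
      rw [← Point.zero_def, zero_add]
      -- `108 - s = (-6)³ w` and `w ^ n = c ^ 3`.
      refine ⟨fun h => absurd h (Point.some_ne_zero _), fun x y h h0 => ⟨-6 / c, ?_⟩⟩
      rw [P0, Point.some.injEq] at h0
      rw [← h0.2, pow_succ, ← hc, map_ofNat]
      field_simp
      linear_combination hw
    · obtain ⟨u, hu⟩ := ih.2 _ _ _ hn
      have hu0 : u ≠ 0 := by
        rintro rfl
        exact hs' y₁ (by rw [hu]; ring)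
      have hsum := (Point.baseChange ℚ L).map_add (Point.some x₁ y₁ h₁) P0
      rw [hP0, Point.map_some] at hsum
      simp only [Algebra.ofId_apply] at hsum
      have he₁ : (E9⁄L).Nonsingular (algebraMap ℚ L x₁) (algebraMap ℚ L y₁) :=
        (E9.baseChange_nonsingular (Algebra.ofId ℚ L).injective x₁ y₁).mpr h₁
      constructor
      · intro h0
        rw [add_eq_zero_iff_eq_neg, P0, Point.neg_some, Point.some.injEq, E9_negY] at h0
        -- Here `n • P0 = -P0`, and `-108 - s = 6³ w² = 6³ w⁻¹`.
        refine ⟨6 / u, ?_⟩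
        rw [h0.2, map_neg, map_ofNat] at hu
        rw [div_pow, div_eq_iff (pow_ne_zero _ hu0), pow_succ]
        linear_combination w * hu + 216 * hw2 - w * hw
      · intro x y h h0
        rw [h0, Point.map_some] at hsum
        simp only [Algebra.ofId_apply] at hsum
        by_cases hxy : algebraMap ℚ L x₁ = 36 ∧ algebraMap ℚ L y₁ = (E9⁄L).negY 36 108
        · rw [Point.add_of_Y_eq hxy.1 hxy.2] at hsum
          exact absurd hsum (Point.some_ne_zero _)
        rw [Point.add_some hxy, Point.some.injEq] at hsum
        have hk := addY_sub_mul_cube he₁.1 hP.1 hxy hs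
        rw [← hsum.1, ← hsum.2] at hk
        set ν := algebraMap ℚ L y₁ -
          (E9⁄L).slope (algebraMap ℚ L x₁) 36 (algebraMap ℚ L y₁) 108 * algebraMap ℚ L x₁ - s
        have h108 : 108 - s ≠ 0 := by simpa using hs' 108
        -- If `ν = 0`, then `hk` forces the rational sum to have abscissa 0.
        have hν : ν ≠ 0 := by
          intro hν
          have hx : x = 0 := by
            rw [hν, zero_pow three_ne_zero, mul_zero, eq_comm, neg_eq_zero, mul_eq_zero,
              or_iff_right (mul_ne_zero (hs' y₁) h108)] at hk
            exact (algebraMap ℚ L).injective ((pow_eq_zero_iff three_ne_zero).mp hk |>.trans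
              (map_zero _).symm)
          have := (E9_equation_iff x y).mp h.1
          rw [hx] at this
          exact rat_sq_ne y (by linear_combination this)
        refine ⟨u * 6 * algebraMap ℚ L x / ν, ?_⟩
        rw [div_pow, mul_div_assoc', eq_div_iff (pow_ne_zero _ hν), hk, hu]
        rw [pow_succ]
        linear_combination (-w ^ n * u ^ 3 * algebraMap ℚ L x ^ 3) * hw

end KummerClass

/-! ### Non-divisibility by 3 in the completion -/

section Local

open IsDedekindDomain HeightOneSpectrum NumberField

/-- Equality would make `z` a unit; since `a` and `b` reduce to 1, the residue of `w ^ n` would be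
the cube of the inverse of that of `z`. Allowing the factors `a` and `b` avoids extracting cube
roots of units congruent to 1. -/
theorem cube_mul_ne (v : HeightOneSpectrum (𝓞 K)) {p : ℕ} (hp : p.Prime)
    (hp9 : p % 9 = 2 ∨ p % 9 = 5) (hv : (p : 𝓞 K) ∈ v.asIdeal) {n : ℕ} (hn : ¬ 3 ∣ n)
    {w a b : v.adicCompletion K} (hw : w ^ 2 + w + 1 = 0) (ha : Valued.v (a - 1) < 1)
    (hb : Valued.v (b - 1) < 1) (z : v.adicCompletion K) : w ^ n * z ^ 3 * a ≠ b := by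
  intro h
  have hval {c : v.adicCompletion K} (hc : Valued.v (c - 1) < 1) : Valued.v c = 1 := by
    have := Valued.v.map_one_add_of_lt hc
    rwa [add_sub_cancel] at this
  have hone {c : v.adicCompletion K} (hc : Valued.v c ^ 3 = 1) : Valued.v c = 1 :=
    (pow_eq_one_iff_of_nonneg zero_le three_ne_zero).mp hc
  have hvw : Valued.v w = 1 := hone (by rw [← map_pow, omega_pow_three hw, map_one])
  have hvz : Valued.v z = 1 := hone (by
    have := congrArg Valued.v h
    simpa [hval ha, hval hb, hvw] using this)
  let w' : v.adicCompletionIntegers K := ⟨w, hvw.le⟩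
  let z' : v.adicCompletionIntegers K := ⟨z, hvz.le⟩
  let a' : v.adicCompletionIntegers K := ⟨a, (hval ha).le⟩
  let b' : v.adicCompletionIntegers K := ⟨b, (hval hb).le⟩
  have hw' : w' ^ 2 + w' + 1 = 0 := Subtype.ext hw
  have h' : w' ^ n * z' ^ 3 * a' = b' := Subtype.ext h
  set res := IsLocalRing.residue (v.adicCompletionIntegers K)
  have ha' : res a' = 1 := by
    rw [← sub_eq_zero, ← map_one res, ← map_sub, residue_eq_zero_iff]; exact ha
  have hb' : res b' = 1 := by
    rw [← sub_eq_zero, ← map_one res, ← map_sub, residue_eq_zero_iff]; exact hb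
  have hrw : res w' ^ 2 + res w' + 1 = 0 := by simpa using congrArg res hw'
  have hr : res w' ^ n * res z' ^ 3 = 1 := by simpa [ha', hb'] using congrArg res h'
  have h3 : (3 : IsLocalRing.ResidueField (v.adicCompletionIntegers K)) ≠ 0 := by
    refine mod_cast natCast_residue_ne_zero v (q := 3) ?_ hv
    refine (Nat.coprime_primes hp Nat.prime_three).mpr ?_
    rintro rfl
    omega
  refine omega_pow_ne_cube h3 hp9 (residue_pow_sq v hp hv) hrw hn (res z')⁻¹ ?_
  rw [inv_pow]
  exact (eq_inv_of_mul_eq_one_left hr).symm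

theorem omega_pow_ne_cube_adicCompletion (v : HeightOneSpectrum (𝓞 K)) {p : ℕ} (hp : p.Prime)
    (hp9 : p % 9 = 2 ∨ p % 9 = 5) (hv : (p : 𝓞 K) ∈ v.asIdeal) {n : ℕ} (hn : ¬ 3 ∣ n)
    {w : v.adicCompletion K} (hw : w ^ 2 + w + 1 = 0) (z : v.adicCompletion K) :
    z ^ 3 ≠ w ^ n := by
  intro hz
  have hw0 : w ≠ 0 := by rintro rfl; norm_num at hw
  refine cube_mul_ne v hp hp9 hv hn hw (a := 1) (b := 1) (by simp) (by simp) z⁻¹ ?_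
  rw [inv_pow, hz, mul_inv_cancel₀ (pow_ne_zero n hw0), one_mul]

theorem exists_sq_eq_adicCompletion (v : HeightOneSpectrum (𝓞 K)) :
    ∃ s w : v.adicCompletion K, s ^ 2 = -34992 ∧ 216 * w = s - 108 := by
  have hchar : CharZero (v.adicCompletion K) := algebraRat.charZero _
  obtain ⟨t, ht⟩ := exists_sq_eq
  refine ⟨algebraMap K (v.adicCompletion K) t, _, ?_, mul_div_cancel₀ _ (by norm_num)⟩
  rw [← map_pow, ht, map_neg]
  exact congrArg _ (map_ofNat _ _)

/-- Reduction is defined on `ℚ_[p]` but Kummer classes live in the completion of `K`; rational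
coordinates link the two, as `p` divides the numerator and not the denominator. -/
theorem valued_rat_lt_one (v : HeightOneSpectrum (𝓞 K)) {p : ℕ} [Fact p.Prime]
    (hv : (p : 𝓞 K) ∈ v.asIdeal) {q : ℚ} (hq : ‖(q : ℚ_[p])‖ < 1) :
    Valued.v (algebraMap ℚ (v.adicCompletion K) q) < 1 := by
  have hp : p.Prime := Fact.out
  have hval (n : 𝓞 K) : Valued.v (algebraMap K (v.adicCompletion K) (algebraMap (𝓞 K) K n)) =
      v.valuation K (algebraMap (𝓞 K) K n) := valuedAdicCompletion_eq_valuation' v _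
  have hnum : (p : ℤ) ∣ q.num := by
    rw [← Padic.norm_intCast_lt_one_iff]
    have h : ((q.num : ℤ) : ℚ_[p]) = (q : ℚ_[p]) * (q.den : ℚ_[p]) := by
      exact_mod_cast (Rat.mul_den_eq_num q).symm
    rw [h, norm_mul]
    exact mul_lt_one_of_nonneg_of_lt_one_left (norm_nonneg _) hq 
      (by simpa using Padic.norm_int_le_one (p := p) q.den)
  have hden : p.Coprime q.den := by
    refine (Nat.Prime.coprime_iff_not_dvd hp).mpr fun h => ?_
    exact Nat.not_coprime_of_dvd_of_dvd hp.one_lt (Int.natCast_dvd.mp hnum) h q.reduced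
  have hmem : (q.num : 𝓞 K) ∈ v.asIdeal := by
    obtain ⟨m, hm⟩ := hnum
    rw [hm]
    push_cast
    exact Ideal.mul_mem_right _ _ hv
  have hnot : (q.den : 𝓞 K) ∉ v.asIdeal := by
    rw [← residue_algebraMap_eq_zero_iff (L := K), map_natCast, map_natCast]
    exact natCast_residue_ne_zero v hden hv
  have h1 : Valued.v ((q.num : ℤ) : v.adicCompletion K) < 1 := by
    have := (valuation_lt_one_iff_mem (K := K) v _).mpr hmem
    rw [← hval] at this
    simpa using this
  have h2 : Valued.v ((q.den : ℕ) : v.adicCompletion K) = 1 := by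
    have := (valuation_eq_one_iff_notMem (K := K) v).mpr hnot
    rw [← hval] at this
    simpa using this
  rw [eq_ratCast, Rat.cast_def, map_div₀, h2, div_one]
  exact h1

open scoped Classical in
theorem not_three_nsmul_adicCompletion (v : HeightOneSpectrum (𝓞 K)) {p : ℕ} (hp : p.Prime)
    (hp9 : p % 9 = 2 ∨ p % 9 = 5) (hv : (p : 𝓞 K) ∈ v.asIdeal)
    (Q : (E9⁄(v.adicCompletion K)).Point) :
    (3 : ℕ) • Q ≠ Point.baseChange ℚ (v.adicCompletion K) P0 := by
  intro hQ
  obtain ⟨h0, hP0⟩ := P0_eq_map (F := v.adicCompletion K)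
  rw [hP0] at hQ
  have hchar : CharZero (v.adicCompletion K) := algebraRat.charZero _
  obtain ⟨s, w, hs, hw⟩ := exists_sq_eq_adicCompletion v
  obtain ⟨x, y, hxy, -, hu⟩ :=
    exists_cube_of_three_nsmul two_ne_zero three_ne_zero (by norm_num) hs hQ
  exact omega_pow_ne_cube_adicCompletion v hp hp9 hv (n := 1) (by norm_num)
    (omega_of_sq_eq two_ne_zero three_ne_zero hs hw) _
    ((omega_eq_cube two_ne_zero three_ne_zero hw hu).trans (pow_one w).symm)

end Local

/-! ### Reduction of `P0` and its multiples modulo `p` -/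

section Reduction

open IsDedekindDomain HeightOneSpectrum NumberField

/-- Write the order of `P` as `ℓ ^ k * m` with `ℓ ∤ m`, and `a ℓ ^ k + b m = 1`. The `ℓ`-part is `(b
* m) • P`; if it vanished, so would `m • P`, and Bézout for `ℓ` and `m` would make `P` a multiple of
`ℓ`. -/
theorem hasNontrivialComponent_of_not_dvd {G : Type*} [AddCommGroup G] {ℓ : ℕ} (hℓ : ℓ.Prime)
    {P : G} (hfin : IsOfFinAddOrder P) (hP : ∀ A : G, ℓ • A ≠ P) : HasNontrivialComponent ℓ P := by
  obtain ⟨k, m, hm, hN⟩ := Nat.exists_eq_pow_mul_and_not_dvd hfin.addOrderOf_pos.ne' ℓ hℓ.ne_one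
  have hcop : ℓ.Coprime m := (Nat.Prime.coprime_iff_not_dvd hℓ).mpr hm
  have hzero : (ℓ ^ k * m) • P = 0 := by rw [← hN]; exact addOrderOf_nsmul_eq_zero P
  obtain ⟨a, b, hab⟩ := Nat.isCoprime_iff_coprime.mpr (hcop.pow_left k)
  have hdiv : m • P ≠ 0 := by
    intro h0
    obtain ⟨c, d, hcd⟩ := Nat.isCoprime_iff_coprime.mpr hcop
    apply hP (c • P)
    have := congrArg (· • P) hcd
    simp only [add_smul, one_smul, mul_smul, natCast_zsmul, h0, smul_zero, add_zero] at this
    rw [smul_comm]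
    exact this
  refine ⟨(b * m) • P, (a * (ℓ ^ k : ℕ)) • P, ?_, ⟨k, ?_⟩, ?_, ?_⟩
  · rw [← add_smul, add_comm, hab, one_smul]
  · rw [mul_smul, natCast_zsmul, smul_comm, ← mul_smul (ℓ ^ k) m P, hzero, smul_zero]
  · refine hcop.coprime_dvd_right (addOrderOf_dvd_of_nsmul_eq_zero ?_)
    rw [mul_smul, natCast_zsmul, smul_comm, ← mul_smul m, mul_comm m, hzero, smul_zero]
  · intro hQ
    apply hdiv
    have := congrArg (· • m • P) hab
    simp only [add_smul, one_smul] at this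
    rw [mul_smul, natCast_zsmul, ← mul_smul (ℓ ^ k) m P, hzero, smul_zero, zero_add,
      smul_comm, hQ, smul_zero] at this
    exact this.symm

instance finite_point {F : Type*} [Field F] [Finite F] (W : WeierstrassCurve.Affine F) :
    Finite W.Point :=
  Finite.of_injective (β := Option {xy : F × F // W.Nonsingular xy.1 xy.2})
    W.nonsingularPointEquiv W.nonsingularPointEquiv.injective

theorem reduction_P0 {p : ℕ} [Fact p.Prime] [DecidableEq ℚ_[p]] (hW : (E9⁄(ZMod p)).Δ ≠ 0) :
    ∃ h, reduction p hW (Point.baseChange ℚ ℚ_[p] P0) = .some 36 108 h := by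
  obtain ⟨h0, hP0⟩ := P0_eq_map (F := ℚ_[p])
  have h36 : ‖(36 : ℚ_[p])‖ ≤ 1 := by simpa using Padic.norm_int_le_one (p := p) 36
  have h108 : ‖(108 : ℚ_[p])‖ ≤ 1 := by simpa using Padic.norm_int_le_one (p := p) 108
  have e36 : PadicInt.toZMod (⟨36, h36⟩ : ℤ_[p]) = 36 := map_ofNat PadicInt.toZMod 36
  have e108 : PadicInt.toZMod (⟨108, h108⟩ : ℤ_[p]) = 108 := map_ofNat PadicInt.toZMod 108
  have hns := (equation_iff_nonsingular_of_Δ_ne_zero hW).mp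
    (equation_toZMod p (x := ⟨36, h36⟩) (y := ⟨108, h108⟩) h0.1)
  rw [e36, e108] at hns
  refine ⟨hns, ?_⟩
  rw [hP0, reduction, dif_pos ⟨h36, h108⟩, Point.some.injEq]
  exact ⟨e36, e108⟩

/-- The reduction of `P₀` modulo `p` is not divisible by `3`, if `𝔽_p` embeds in a field that
contains a primitive cube root of unity and is fixed by the `p ^ 2`-power map. -/
theorem three_nsmul_ne_of_ringHom {p : ℕ} [Fact p.Prime] [DecidableEq (ZMod p)] {k : Type*}
    [Field k] (f : ZMod p →+* k) (h2 : (2 : k) ≠ 0) (h3 : (3 : k) ≠ 0) (hp9 : p % 9 = 2 ∨ p % 9 = 5)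
    (hk : ∀ z : k, z ^ p ^ 2 = z) {w : k} (hw : w ^ 2 + w + 1 = 0)
    {h : (E9⁄(ZMod p)).Nonsingular 36 108} (A : (E9⁄(ZMod p)).Point) :
    (3 : ℕ) • A ≠ .some 36 108 h := by
  classical
  intro hA
  have hmap := congrArg (Point.map f.toIntAlgHom) hA
  rw [map_nsmul, Point.map_some] at hmap
  -- This inverts `216 * w = s - 108`, recovering `s` from `w`.
  have hs : (216 * w + 108) ^ 2 = -34992 := by linear_combination 46656 * hw
  have h108 : f.toIntAlgHom (108 : ZMod p) = 108 := map_ofNat f 108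
  have h0 : (108 : k) ≠ 0 := by
    rw [show (108 : k) = 2 ^ 2 * 3 ^ 3 by norm_num]
    exact mul_ne_zero (pow_ne_zero _ h2) (pow_ne_zero _ h3)
  obtain ⟨x, y, hxy, -, hu⟩ := exists_cube_of_three_nsmul h2 h3 (by rwa [h108]) hs hmap
  rw [h108] at hu
  exact omega_pow_ne_cube h3 hp9 hk hw (n := 1) (by norm_num) _
    ((omega_eq_cube h2 h3 (by ring) hu).trans (pow_one w).symm)

theorem exists_omega_residueField (v : HeightOneSpectrum (𝓞 K)) :
    ∃ w : IsLocalRing.ResidueField (v.adicCompletionIntegers K), w ^ 2 + w + 1 = 0 := by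
  have hchar : CharZero (v.adicCompletion K) := algebraRat.charZero _
  obtain ⟨s, w, hs, hw⟩ := exists_sq_eq_adicCompletion v
  have hw1 := omega_of_sq_eq two_ne_zero three_ne_zero hs hw
  have hvw : Valued.v w = 1 := (pow_eq_one_iff_of_nonneg zero_le three_ne_zero).mp
    (by rw [← map_pow, omega_pow_three hw1, map_one])
  have hw' : (⟨w, hvw.le⟩ : v.adicCompletionIntegers K) ^ 2 + ⟨w, hvw.le⟩ + 1 = 0 :=
    Subtype.ext hw1
  exact ⟨_, by simpa using congrArg (IsLocalRing.residue (v.adicCompletionIntegers K)) hw'⟩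

theorem hasNontrivialComponent_reduction_P0 {p : ℕ} [Fact p.Prime] [DecidableEq ℚ_[p]]
    [DecidableEq (ZMod p)] (hp : p ≠ 2) (hp9 : p % 9 = 2 ∨ p % 9 = 5) :
    HasNontrivialComponent 3
      (reduction p (E9_disc_ne_zero hp hp9) (Point.baseChange ℚ ℚ_[p] P0)) := by
  have hpp : p.Prime := Fact.out
  refine hasNontrivialComponent_of_not_dvd Nat.prime_three (isOfFinAddOrder_of_finite _) ?_
  obtain ⟨h0, hred⟩ := reduction_P0 (E9_disc_ne_zero hp hp9)
  rw [hred]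
  obtain ⟨v, hv⟩ := exists_heightOneSpectrum hpp
  obtain ⟨w, hw⟩ := exists_omega_residueField v
  have hp0 : ((p : ℕ) : IsLocalRing.ResidueField (v.adicCompletionIntegers K)) = 0 := by
    have := (residue_algebraMap_eq_zero_iff (L := K) v (p : 𝓞 K)).mpr hv
    simpa using this
  have hcharP : CharP (IsLocalRing.ResidueField (v.adicCompletionIntegers K)) p :=
    ringChar.of_eq (CharP.ringChar_of_prime_eq_zero hpp hp0)
  have h2 := natCast_residue_ne_zero v ((Nat.coprime_primes hpp Nat.prime_two).mpr hp) hv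
  have h3 := natCast_residue_ne_zero v
    ((Nat.coprime_primes hpp Nat.prime_three).mpr (by rintro rfl; omega)) hv
  exact three_nsmul_ne_of_ringHom (ZMod.castHom dvd_rfl _) (mod_cast h2) (mod_cast h3) hp9
    (residue_pow_sq v hpp hv) hw

/-- A point of `E₉` with a coordinate outside `ℤ_p` has both coordinates outside `ℤ_p`. -/
theorem one_lt_norm_of_not_integral {p : ℕ} [Fact p.Prime] {x y : ℚ_[p]}
    (h : y ^ 2 = x ^ 3 - 34992) (hxy : ¬ (‖x‖ ≤ 1 ∧ ‖y‖ ≤ 1)) : 1 < ‖x‖ ∧ 1 < ‖y‖ := by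
  have hc : ‖(34992 : ℚ_[p])‖ ≤ 1 := by simpa using Padic.norm_int_le_one (p := p) 34992
  have hx : 1 < ‖x‖ := by
    by_contra! hx
    refine hxy ⟨hx, ?_⟩
    have : ‖y‖ ^ 2 ≤ 1 := by
      rw [← norm_pow, h, sub_eq_add_neg]
      refine (IsUltrametricDist.norm_add_le_max _ _).trans (max_le ?_ (by rwa [norm_neg]))
      rw [norm_pow]
      exact pow_le_one₀ (norm_nonneg _) hx
    exact (pow_le_one_iff_of_nonneg (norm_nonneg _) two_ne_zero).mp this
  refine ⟨hx, ?_⟩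
  by_contra! hy
  have : ‖x‖ ^ 3 ≤ 1 := by
    rw [← norm_pow, show x ^ 3 = y ^ 2 + 34992 by rw [h]; ring]
    refine (IsUltrametricDist.norm_add_le_max _ _).trans (max_le ?_ hc)
    rw [norm_pow]
    exact pow_le_one₀ (norm_nonneg _) hy
  exact hx.not_ge ((pow_le_one_iff_of_nonneg (norm_nonneg _) three_ne_zero).mp this)

/-- A nonintegral point has `Y² / X³` and `(Y - s) / Y` congruent to 1, so `Y - s` is a cube times a
unit congruent to 1. That is incompatible with the class `w ^ m`. The argument uses coordinates, not
additivity of reduction. -/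
theorem reduction_nsmul_P0_ne_zero {p : ℕ} [Fact p.Prime] [DecidableEq ℚ_[p]] (hp : p ≠ 2)
    (hp9 : p % 9 = 2 ∨ p % 9 = 5) {m : ℕ} (hm : ¬ 3 ∣ m) :
    reduction p (E9_disc_ne_zero hp hp9) (Point.baseChange ℚ ℚ_[p] (m • P0)) ≠ 0 := by
  classical
  have hpp : p.Prime := Fact.out
  obtain ⟨v, hv⟩ := exists_heightOneSpectrum hpp
  obtain ⟨s, w, hs, hw⟩ := exists_sq_eq_adicCompletion v
  have hkum := kummer_nsmul_P0 hs hw m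
  have hw1 : w ^ 2 + w + 1 = 0 := by
    have hchar : CharZero (v.adicCompletion K) := algebraRat.charZero _
    exact omega_of_sq_eq two_ne_zero three_ne_zero hs hw
  rcases hmP : m • P0 with _ | ⟨x, y, hxy⟩
  · obtain ⟨u, hu⟩ := hkum.1 hmP
    exact absurd hu (omega_pow_ne_cube_adicCompletion v hpp hp9 hv hm hw1 u)
  obtain ⟨u, hu⟩ := hkum.2 x y hxy hmP
  rw [Point.map_some, reduction]
  split_ifs with hint
  · exact Point.some_ne_zero _
  exfalso
  have he := (E9_equation_iff x y).mp hxy.1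
  simp only [eq_ratCast] at hint
  obtain ⟨hx, hy⟩ := one_lt_norm_of_not_integral
    (by exact_mod_cast congrArg (Rat.cast (K := ℚ_[p])) he) hint
  have hx0 : x ≠ 0 := by rintro rfl; norm_num at hx
  have hy0 : y ≠ 0 := by rintro rfl; norm_num at hy
  have hvx : Valued.v (algebraMap ℚ (v.adicCompletion K) x⁻¹) < 1 := by
    refine valued_rat_lt_one v hv (p := p) ?_
    rw [Rat.cast_inv, norm_inv]; exact inv_lt_one_of_one_lt₀ hx
  have hvy : Valued.v (algebraMap ℚ (v.adicCompletion K) y⁻¹) < 1 := by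
    refine valued_rat_lt_one v hv (p := p) ?_
    rw [Rat.cast_inv, norm_inv]; exact inv_lt_one_of_one_lt₀ hy
  rw [map_inv₀] at hvx hvy
  have heL := congrArg (algebraMap ℚ (v.adicCompletion K)) he
  rw [map_sub, map_pow, map_pow, map_ofNat] at heL
  have hX0 := (map_ne_zero (algebraMap ℚ (v.adicCompletion K))).mpr hx0
  have hY0 := (map_ne_zero (algebraMap ℚ (v.adicCompletion K))).mpr hy0
  generalize algebraMap ℚ (v.adicCompletion K) x = X at *
  generalize algebraMap ℚ (v.adicCompletion K) y = Y at *
  have hvc : Valued.v (34992 : v.adicCompletion K) ≤ 1 := by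
    have h := coe_mem_adicCompletionIntegers (K := K) v (34992 : 𝓞 K)
    rw [mem_adicCompletionIntegers] at h
    convert h
    exact (map_ofNat (algebraMap (𝓞 K) (v.adicCompletion K)) 34992).symm
  have hvs : Valued.v s ≤ 1 := by
    refine (pow_le_one_iff_of_nonneg zero_le two_ne_zero).mp ?_
    rwa [← map_pow, hs, Valuation.map_neg]
  -- With `a = Y² / X³` and `b = (Y - s) / Y`, the relation `w ^ m * (u * X / Y) ^ 3 * a = b` is `Y
  -- - s = w ^ m * u ^ 3` divided by `Y`.
  refine cube_mul_ne v hpp hp9 hv hm hw1 (a := 1 - 34992 * X⁻¹ ^ 3) (b := 1 - s * Y⁻¹) ?_ ?_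
    (u * X / Y) ?_
  · rw [sub_sub_cancel_left, Valuation.map_neg, map_mul, map_pow]
    exact (mul_le_of_le_one_left zero_le hvc).trans_lt (pow_lt_one₀ zero_le hvx three_ne_zero)
  · rw [sub_sub_cancel_left, Valuation.map_neg, map_mul]
    exact (mul_le_of_le_one_left zero_le hvs).trans_lt hvy
  · have h1 : 1 - 34992 * X⁻¹ ^ 3 = Y ^ 2 / X ^ 3 := by
      rw [heL]; field_simp
    rw [h1, div_pow, mul_pow]
    field_simp
    linear_combination -hu

end Reduction

end CubeSum

open CubeSum WeierstrassCurve.Affine IsDedekindDomain NumberField in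
open scoped Classical in
theorem mainTheorem6 :
    (∀ (ι : AlgebraicClosure ℚ →ₐ[ℚ] ℂ) (A : (E9⁄(AlgebraicClosure ℚ)).Point),
      (3 : ℕ) • A = Point.baseChange ℚ (AlgebraicClosure ℚ) P0 →
      IntermediateField.adjoin ℚ {Complex.exp (2 * Real.pi * Complex.I / 9)} ≤
        (fieldOfPointAndThreeTorsion A).map ι) ∧
    ∀ (p : ℕ) [Fact p.Prime] (hp : p ≠ 2) (hp9 : p % 9 = 2 ∨ p % 9 = 5),
      (∀ v : HeightOneSpectrum (𝓞 K), (p : 𝓞 K) ∈ v.asIdeal →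
        ¬ ∃ Q : (E9⁄(v.adicCompletion K)).Point,
          (3 : ℕ) • Q = Point.baseChange ℚ (v.adicCompletion K) P0) ∧
      HasNontrivialComponent 3
        (reduction p (E9_disc_ne_zero hp hp9) (Point.baseChange ℚ ℚ_[p] P0)) ∧
      reduction p (E9_disc_ne_zero hp hp9)
        (Point.baseChange ℚ ℚ_[p] (((p + 1) / 3) • P0)) ≠ 0 := by
  refine ⟨adjoin_zeta_nine_le, fun p _ hp hp9 => ⟨fun v hv => ?_, ?_, ?_⟩⟩
  · rintro ⟨Q, hQ⟩
    exact not_three_nsmul_adicCompletion v Fact.out hp9 hv Q hQ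
  · exact hasNontrivialComponent_reduction_P0 hp hp9
  -- `p + 1` is 3 or 6 modulo 9, so `(p + 1) / 3` is exact and prime to 3.
  · exact reduction_nsmul_P0_ne_zero hp hp9 (by omega)
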